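/- Let $k\ge 3$ be an integer and let $H=\mathrm{Sym}(k)\wr\mathrm{Sym}(2)\le G=\mathrm{Sym}(2k)$ in its imprimitive action on $[2k]=\{1,\dots,2k\}$ with blocks $\{1,\dots,k\}$ and $\{k+1,\dots,2k\}$. For a partition $\lambda\vdash n$ let $\chi^\lambda$ be the irreducible character of $\mathrm{Sym}(n)$ afforded by the Specht module $S^\lambda$, let $\mathrm{Sym}(\lambda)$ be the Young subgroup of $\lambda$ (whose factors act on consecutive intervals of $[n]$), let $\mathbf 1_H^G$ be the character of $G$ induced from the trivial character of $H$, and put $\Lambda(2k,H)=\{\lambda\vdash 2k:\langle \mathbf 1_H^G,\chi^\lambda\rangle=1\}$. An orbital of $G$ on a $G$-set $X$ is an orbit $O$ of $G$ on $X\times X$; its orbital (di)graph has an arc $x\to y$ whenever $(x,y)\in O$; a set $T\subseteq X$ is a coclique of it if no $(x,y)\in O$ has $x,y\in T$. Then: 1. $H$ is a multiplicity-free subgroup of $G$: every irreducible complex character of $G$ has multiplicity $0$ or $1$ in $\mathbf 1_H^G$. 2. The second largest partition in dominance ordering in $\Lambda(2k,H)$ is $[2k-2,2]$: both $[2k]$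 and $[2k-2,2]$ lie in $\Lambda(2k,H)$, and $[2k-2,2]$ dominates every element of $\Lambda(2k,H)$ other than $[2k]$. 3. Let $U_k$ be the set of partitions of $[2k]$ into two blocks of size $k$. Then $G$ acts transitively on $U_k$ and $H$ is the stabilizer of $\{\{1,\dots,k\},\{k+1,\dots,2k\}\}$. The orbits of $\mathrm{Sym}([2k-2,2])$ on $U_k$ are exactly $\mathcal S$ and $U_k\setminus\mathcal S$, where $\mathcal S$ is the set of those partitions in $U_k$ that have $2k-1$ and $2k$ in the same block. 4. Neither $\mathcal S$ nor $U_k\setminus\mathcal S$ is a coclique of any orbital graph of $G$ on $U_k$. 5. Consequently the question of Godsil and Meagher, "is there an orbital graph of $G$ acting on $G/H$ in which an orbit of $\mathrm{Sym}(\lambda)$ on $G/H$ is a coclique, where $\lambda$ is the second largest partition in $\Lambda(2k,H)$ (and is the eigenvalue belonging to the $\lambda$-module the least eigenvalue of such graphs)?", has a negative answer for $(G,H)$: no orbit of $\mathrm{Sym}([2k-2,2])$ on $G/H$ is a coclique of any orbital graph of $G$ on $G/H$. -/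

import Mathlib

noncomputable section

namespace GelfandSym

/-! ### Partitions, Young subgroups, Specht modules -/

/-- `partialSum p j = p₁ + ⋯ + pⱼ`, where `p₁ ≥ p₂ ≥ ⋯` are the parts of `p`. -/
def partialSum {n : ℕ} (p : n.Partition) (j : ℕ) : ℕ :=
  ((p.parts.sort (· ≥ ·)).take j).sum

/-- `Dominates p q` : the partition `p` dominates the partition `q`. -/
def Dominates {n : ℕ} (p q : n.Partition) : Prop :=
  ∀ j, partialSum q j ≤ partialSum p j

/-- Row (counted from `0`) of the entry `i` in the tableau of shape `p` whose rows are filled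
consecutively: the first row is `0, …, p₁ - 1`, the second is `p₁, …, p₁ + p₂ - 1`, and so on. -/
def row {n : ℕ} (p : n.Partition) (i : Fin n) : ℕ :=
  ((Finset.range (Multiset.card p.parts)).filter
    (fun j => partialSum p (j + 1) ≤ (i : ℕ))).card

/-- Column (counted from `0`) of the entry `i` in the same tableau. -/
def col {n : ℕ} (p : n.Partition) (i : Fin n) : ℕ :=
  (i : ℕ) - partialSum p (row p i)

/-- The permutations of `α` that preserve every fibre of `f`. -/
def fibrePreserving {α : Type*} (f : α → ℕ) : Subgroup (Equiv.Perm α) where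
  carrier := {σ | ∀ i, f (σ i) = f i}
  mul_mem' := fun {σ τ} hσ hτ i => by
    rw [Equiv.Perm.mul_apply, hσ, hτ]
  one_mem' := fun _ => rfl
  inv_mem' := fun {σ} hσ i => by
    have h := hσ (σ⁻¹ i)
    rw [← Equiv.Perm.mul_apply, mul_inv_cancel] at h
    exact h.symm

/-- The Young subgroup `Sym(p₁) × Sym(p₂) × ⋯` of `Sym(n)`; it is also the row stabilizer of the
tableau above. -/
def youngSubgroup {n : ℕ} (p : n.Partition) : Subgroup (Equiv.Perm (Fin n)) :=
  fibrePreserving (row p)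

/-- The column stabilizer of the tableau above. -/
def columnSubgroup {n : ℕ} (p : n.Partition) : Subgroup (Equiv.Perm (Fin n)) :=
  fibrePreserving (col p)

open Classical in
/-- The Young symmetrizer `(∑ σ in C, sign(σ) σ) (∑ ρ in R, ρ)` in `ℂ[Sym(n)]`, where `R` and `C`
are the row and the column stabilizer. -/
def youngSymmetrizer {n : ℕ} (p : n.Partition) : MonoidAlgebra ℂ (Equiv.Perm (Fin n)) :=
  (∑ σ : Equiv.Perm (Fin n), if σ ∈ columnSubgroup p then
      MonoidAlgebra.single σ (((Equiv.Perm.sign σ : ℤˣ) : ℤ) : ℂ) else 0) *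
  (∑ σ : Equiv.Perm (Fin n), if σ ∈ youngSubgroup p then
      MonoidAlgebra.single σ (1 : ℂ) else 0)

/-- The Specht module of `p`, as the left ideal of `ℂ[Sym(n)]` generated by the Young symmetrizer
(equivalently, the span of the polytabloids in the permutation module of `p`). -/
def spechtModule {n : ℕ} (p : n.Partition) : Ideal (MonoidAlgebra ℂ (Equiv.Perm (Fin n))) :=
  Ideal.span {youngSymmetrizer p}

/-- The representation of `Sym(n)` on the Specht module, by left multiplication. -/
def spechtRep {n : ℕ} (p : n.Partition) :
    Representation ℂ (Equiv.Perm (Fin n)) (spechtModule p) :=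
  Representation.ofModule' (spechtModule p)

/-- The irreducible character of `Sym(n)` indexed by the partition `p`. -/
def spechtCharacter {n : ℕ} (p : n.Partition) : Equiv.Perm (Fin n) → ℂ :=
  (spechtRep p).character

/-! ### Multiplicity-free subgroups -/

section Characters

variable {G : Type*} [Group G] [Fintype G]

/-- The inner product of complex functions on a finite group. -/
def charInner (φ ψ : G → ℂ) : ℂ :=
  (Fintype.card G : ℂ)⁻¹ * ∑ g : G, φ g * (starRingEnd ℂ) (ψ g)

open Classical in
/-- The function on `G` induced from a class function `φ` on the subgroup `H`. -/
def inducedCharacter (H : Subgroup G) (φ : H → ℂ) (g : G) : ℂ :=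
  (Nat.card H : ℂ)⁻¹ * ∑ x : G, if h : x⁻¹ * g * x ∈ H then φ ⟨x⁻¹ * g * x, h⟩ else 0

/-- The character of `G` induced from the trivial character of `H`. -/
def permCharacter (H : Subgroup G) : G → ℂ :=
  inducedCharacter H (fun _ => 1)

/-- `H` is a multiplicity-free subgroup of `G` (that is, `(G, H)` is a Gelfand pair): every
irreducible complex character has multiplicity `0` or `1` in the character induced from the trivial
character of `H`. -/
def IsMultiplicityFree (H : Subgroup G) : Prop :=
  ∀ (V : Type) [AddCommGroup V] [Module ℂ V] [FiniteDimensional ℂ V]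
    (ρ : Representation ℂ G V), ρ.IsIrreducible →
      charInner (permCharacter H) ρ.character = 0 ∨ charInner (permCharacter H) ρ.character = 1

end Characters

/-- The set `Λ(n, H)` of the partitions of `n` whose irreducible character has multiplicity `1` in
the character induced from the trivial character of `H`. -/
def Lam {n : ℕ} (H : Subgroup (Equiv.Perm (Fin n))) : Set n.Partition :=
  {p | charInner (permCharacter H) (spechtCharacter p) = 1}

/-- `p` is the second largest element of `L` in dominance ordering: `L` contains `[n]` (which
dominates every partition of `n`), and `p` is the largest among the other elements of `L`. -/
def IsSecondLargest {n : ℕ} (L : Set n.Partition) (p : n.Partition) : Prop :=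
  Nat.Partition.indiscrete n ∈ L ∧ p ∈ L ∧ p ≠ Nat.Partition.indiscrete n ∧
    ∀ q ∈ L, q ≠ Nat.Partition.indiscrete n → Dominates p q

/-! ### Orbits, orbitals, cocliques -/

/-- `S` is an orbit of the group `K` on `X`. -/
def IsOrbit (K : Type*) {X : Type*} [Group K] [MulAction K X] (S : Set X) : Prop :=
  ∃ x : X, S = MulAction.orbit K x

/-- `O` is an orbital of `G` on `X`, i.e. an orbit of `G` on `X × X`. The orbital (di)graph of `O`
has vertex set `X` and an arc from `x` to `y` for each `(x, y) ∈ O`. -/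
def IsOrbital (G : Type*) {X : Type*} [Group G] [MulAction G X] (O : Set (X × X)) : Prop :=
  IsOrbit G O

/-- `S` is a coclique of the digraph on `X` with arc set `O`. -/
def IsCoclique {X : Type*} (O : Set (X × X)) (S : Set X) : Prop :=
  ∀ x ∈ S, ∀ y ∈ S, (x, y) ∉ O

/-! ### The wreath product and the uniform partitions into two blocks -/

/-- The wreath product `Sym(k) ≀ Sym(m)` in its imprimitive action on `Fin (m * k)`, the union of
the blocks `{a * k, …, a * k + k - 1}` for `a < m`: an element permutes the blocks by some
`τ ∈ Sym(m)` and acts on the points of the block `a` through some `f a ∈ Sym(k)`. -/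
def wreathSym (k m : ℕ) : Subgroup (Equiv.Perm (Fin (m * k))) where
  carrier := {σ | ∃ (τ : Equiv.Perm (Fin m)) (f : Fin m → Equiv.Perm (Fin k)),
    ∀ (a : Fin m) (b : Fin k), σ (finProdFinEquiv (a, b)) = finProdFinEquiv (τ a, f a b)}
  mul_mem' := by
    rintro σ σ' ⟨τ, f, h⟩ ⟨τ', f', h'⟩
    refine ⟨τ * τ', fun a => f (τ' a) * f' a, fun a b => ?_⟩
    rw [Equiv.Perm.mul_apply, h', h]
    rfl
  one_mem' := ⟨1, fun _ => 1, fun _ _ => rfl⟩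
  inv_mem' := by
    rintro σ ⟨τ, f, h⟩
    refine ⟨τ⁻¹, fun a => (f (τ⁻¹ a))⁻¹, fun a b => ?_⟩
    rw [Equiv.Perm.inv_eq_iff_eq, h, ← Equiv.Perm.mul_apply, mul_inv_cancel,
      ← Equiv.Perm.mul_apply, mul_inv_cancel]
    rfl

/-- The set `U_k` of the partitions of a set of `2k` points into two blocks of size `k`. -/
def UniformPartition (k : ℕ) : Type :=
  {P : Finset (Finset (Fin (2 * k))) // ∃ B₁ B₂ : Finset (Fin (2 * k)),
    B₁ ∪ B₂ = Finset.univ ∧ Disjoint B₁ B₂ ∧ B₁.card = k ∧ B₂.card = k ∧ P = {B₁, B₂}}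

/-- The action of `Sym(2k)` on `U_k` induced by the action on points. -/
instance uniformPartitionAction (k : ℕ) :
    MulAction (Equiv.Perm (Fin (2 * k))) (UniformPartition k) where
  smul σ P := ⟨P.1.image (fun B => B.image σ), by
    obtain ⟨B₁, B₂, hu, hd, h₁, h₂, hP⟩ := P.2
    refine ⟨B₁.image σ, B₂.image σ, ?_, ?_, ?_, ?_, ?_⟩
    · rw [← Finset.image_union, hu, Finset.image_univ_of_surjective σ.surjective]
    · exact (Finset.disjoint_image σ.injective).2 hd
    · rw [Finset.card_image_of_injective _ σ.injective, h₁]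
    · rw [Finset.card_image_of_injective _ σ.injective, h₂]
    · rw [hP, Finset.image_insert, Finset.image_singleton]⟩
  one_smul P := Subtype.ext (by
    change P.1.image (fun B => B.image (1 : Equiv.Perm (Fin (2 * k)))) = P.1
    simp)
  mul_smul σ τ P := Subtype.ext (by
    change P.1.image (fun B => B.image (σ * τ : Equiv.Perm (Fin (2 * k)))) =
      (P.1.image (fun B => B.image τ)).image (fun B => B.image σ)
    rw [Finset.image_image]
    congr 1
    funext B
    simp only [Function.comp_apply, Finset.image_image, Equiv.Perm.coe_mul])

/-- The partition of the `2k` points into the first `k` and the last `k` points. -/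
def basePartition (k : ℕ) : UniformPartition k :=
  ⟨{Finset.univ.filter (fun i : Fin (2 * k) => (i : ℕ) < k),
      Finset.univ.filter (fun i : Fin (2 * k) => ¬ (i : ℕ) < k)},
    Finset.univ.filter (fun i : Fin (2 * k) => (i : ℕ) < k),
    Finset.univ.filter (fun i : Fin (2 * k) => ¬ (i : ℕ) < k),
    Finset.filter_union_filter_not_eq _ _, Finset.disjoint_filter_filter_not _ _ _,
    by rw [Fin.card_filter_val_lt]; omega,
    by
      have h := Finset.card_filter_add_card_filter_not (s := (Finset.univ : Finset (Fin (2 * k))))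
        (fun i => (i : ℕ) < k)
      rw [Fin.card_filter_val_lt, Finset.card_univ, Fintype.card_fin] at h
      omega,
    rfl⟩

/-- The partition `[2k - 2, 2]` of `2k`, for `k ≥ 3`. -/
def partitionTwo (k : ℕ) (hk : 3 ≤ k) : (2 * k).Partition where
  parts := {2 * k - 2, 2}
  parts_pos := by
    intro i hi
    simp only [Multiset.insert_eq_cons, Multiset.mem_cons, Multiset.mem_singleton] at hi
    omega
  parts_sum := by
    simp only [Multiset.insert_eq_cons, Multiset.sum_cons, Multiset.sum_singleton]
    omega

/-- The partitions in `U_k` that have the last two points (the points `2k - 1` and `2k` when one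
counts from `1`) in the same block. -/
def lastTwoTogether (k : ℕ) : Set (UniformPartition k) :=
  {P | ∃ B ∈ P.1, ∀ i : Fin (2 * k), 2 * k - 2 ≤ (i : ℕ) → i ∈ B}

end GelfandSym

end

open GelfandSym

/-!
Write `X` for the set of partitions of the `2k` points into two blocks of size `k`. By
`exists_perm_image_pair`, a permutation moves one pair of subsets to another whenever the
cardinalities of the two subsets and of their intersection agree. This one fact describes the
orbits of `Sym(2k)` and of its Young subgroups with two factors on `X`, and the orbitals of
`Sym(2k)` on `X`.

*Multiplicity-freeness* is Gelfand's trick. Two elements of `X` can be exchanged by a permutation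
(`exists_perm_swap`), so every double coset of the wreath product `H` is closed under inversion
(`exists_inv_eq_mul_mul`). Hence the operators `e g e`, where `e` is the sum of the elements of `H`,
commute on every representation (`heckeOperator_commute`); on an irreducible representation they act
on the `H`-fixed vectors by scalars and generate that space from any nonzero vector, so its dimension
is at most one (`finrank_invariants_le_one`). That dimension is the multiplicity in question
(`charInner_permCharacter`).

*The second largest partition.* An `H`-fixed element of the Specht module of `p`, read as a function
on `Sym(2k)`, is left `H`-invariant and right invariant under the Young subgroup `Y` of `p`; it is
thus a function on the `Y`-orbits on `X` (`coeff_eq_of_smul_eq`), and its values sum to zero if the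
column stabilizer has an odd element (`sum_coeff_eq_zero`). For `p = [2k - 1, 1]` there is one orbit,
so no nonzero fixed vector exists. For `p = [2k - 2, 2]` there are two orbits, so the fixed space is
at most a line, and the projection of the Young symmetrizer to it is nonzero because its coefficient
at the identity is a sum of nonnegative terms (`exists_mem_invariants_ne_zero`). Apart from `[2k]`
and `[2k - 1, 1]` every partition of `2k` is dominated by `[2k - 2, 2]`.

*Cocliques.* For `k ≥ 3` the blocks of two elements of `X` can be named `B, Bᶜ` and `C, Cᶜ` so that
`B ∩ C` has two points and `Bᶜ ∩ Cᶜ` is nonempty (`exists_blocks_inter`). Moving two points of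
`B ∩ C` to the last two points, or one point of `Bᶜ ∩ Cᶜ` and one of `B ∩ C`, gives a pair in the
same orbital inside either of the two `Y`-orbits. The statement on cosets of `H` follows by transport
along the identification of `Sym(2k) ⧸ H` with `X` (`not_isCoclique_quotient`).
-/

namespace GelfandSym

/-! ### Multiplicities as dimensions of spaces of fixed vectors -/

theorem span_orbit_eq_top {G : Type*} [Group G] {V : Type*} [AddCommGroup V] [Module ℂ V]
    {ρ : Representation ℂ G V} (hρ : ρ.IsIrreducible) {v : V} (hv : v ≠ 0) :
    Submodule.span ℂ (Set.range fun g => ρ g v) = ⊤ := by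
  let W : Subrepresentation ρ :=
    { toSubmodule := Submodule.span ℂ (Set.range fun g => ρ g v)
      apply_mem_toSubmodule := fun g w hw => by
        have hle : Submodule.span ℂ (Set.range fun g => ρ g v) ≤
            (Submodule.span ℂ (Set.range fun g => ρ g v)).comap (ρ g) := by
          rw [Submodule.span_le]
          rintro _ ⟨x, rfl⟩
          exact Submodule.subset_span ⟨g * x, by simp⟩
        exact hle hw }
  have hvW : v ∈ W.toSubmodule := Submodule.subset_span ⟨1, by simp⟩
  rcases hρ.eq_bot_or_eq_top W with h | h
  · rw [h] at hvW
    exact absurd ((Submodule.mem_bot ℂ).1 hvW) hv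
  · exact congrArg Subrepresentation.toSubmodule h

section FixedVectors

variable {G : Type*} [Group G] [Fintype G] {V : Type*} [AddCommGroup V] [Module ℂ V]

/-- Frobenius reciprocity for the trivial character of a subgroup `H`: the multiplicity of a
character in the permutation character of `H` is the dimension of the space of `H`-fixed vectors. -/
theorem charInner_permCharacter [FiniteDimensional ℂ V] (H : Subgroup G)
    (ρ : Representation ℂ G V) :
    charInner (permCharacter H) ρ.character =
      Module.finrank ℂ (Representation.invariants (ρ.comp H.subtype)) := by
  classical
  have hH : (Nat.card H : ℂ) ≠ 0 := by exact_mod_cast Nat.card_pos.ne'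
  have hG : (Fintype.card G : ℂ) ≠ 0 := by exact_mod_cast Fintype.card_pos.ne'
  let _ : Invertible (Nat.card H : ℂ) := invertibleOfNonzero hH
  set c : ℂ := ∑ h : H, (starRingEnd ℂ) (ρ.character (h : G)) with hc
  -- For fixed `x`, the elements `g` with `x⁻¹ g x ∈ H` are the conjugates `x h x⁻¹`.
  have hx (x : G) : ∑ g : G, (if x⁻¹ * g * x ∈ H then (1 : ℂ) else 0) *
      (starRingEnd ℂ) (ρ.character g) = c := by
    rw [← Equiv.sum_comp (MulAut.conj x).toEquiv]
    simp only [MulEquiv.toEquiv_eq_coe, MulEquiv.coe_toEquiv, MulAut.conj_apply,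
      ← mul_assoc, inv_mul_cancel, one_mul, inv_mul_cancel_right, Representation.char_conj]
    simp only [ite_mul, one_mul, zero_mul]
    rw [hc, ← Finset.sum_filter]
    exact (Finset.sum_subtype _ (by simp) _)
  have hsum : ∑ g : G, permCharacter H g * (starRingEnd ℂ) (ρ.character g) =
      (Nat.card H : ℂ)⁻¹ * (Fintype.card G * c) := by
    calc _ = ∑ g : G, ∑ x : G, (Nat.card H : ℂ)⁻¹ *
          ((if x⁻¹ * g * x ∈ H then (1 : ℂ) else 0) * (starRingEnd ℂ) (ρ.character g)) := by
          refine Finset.sum_congr rfl fun g _ => ?_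
          simp only [permCharacter, inducedCharacter, dite_eq_ite]
          rw [mul_assoc, Finset.sum_mul, Finset.mul_sum]
      _ = _ := by
          rw [Finset.sum_comm]
          simp only [← Finset.mul_sum, hx, Finset.sum_const, Finset.card_univ, nsmul_eq_mul]
  have havg := Representation.card_inv_mul_sum_char_eq_finrank (ρ.comp H.subtype)
  have hconj := congrArg (starRingEnd ℂ) havg
  rw [map_mul, map_sum, map_inv₀, map_natCast, map_natCast] at hconj
  rw [charInner, hsum, ← hconj, mul_left_comm, inv_mul_cancel_left₀ hG]
  rfl

/-- The sum of the operators by which the elements of `H` act. -/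
noncomputable def subgroupSum (H : Subgroup G) (ρ : Representation ℂ G V) : Module.End ℂ V :=
  open Classical in ∑ h : H, ρ h

/-- The action on `V` of the sum of the double coset `H g H`, counted with multiplicity. -/
noncomputable def heckeOperator (H : Subgroup G) (ρ : Representation ℂ G V) (g : G) :
    Module.End ℂ V :=
  subgroupSum H ρ * ρ g * subgroupSum H ρ

variable {H : Subgroup G} {ρ : Representation ℂ G V}

theorem subgroupSum_mul_of_mem {h : G} (hh : h ∈ H) :
    subgroupSum H ρ * ρ h = subgroupSum H ρ := by
  classical
  rw [subgroupSum, Finset.sum_mul]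
  exact Fintype.sum_equiv (Equiv.mulRight (⟨h, hh⟩ : H)) _ _ fun x => by simp

theorem of_mem_mul_subgroupSum {h : G} (hh : h ∈ H) :
    ρ h * subgroupSum H ρ = subgroupSum H ρ := by
  classical
  rw [subgroupSum, Finset.mul_sum]
  exact Fintype.sum_equiv (Equiv.mulLeft (⟨h, hh⟩ : H)) _ _ fun x => by simp

theorem subgroupSum_apply_of_fixed {v : V}
    (hv : v ∈ Representation.invariants (ρ.comp H.subtype)) :
    subgroupSum H ρ v = (Nat.card H : ℂ) • v := by
  classical
  have hv' (h : H) : ρ h v = v := hv h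
  rw [subgroupSum, LinearMap.sum_apply]
  simp [hv', Nat.cast_smul_eq_nsmul]

theorem subgroupSum_apply_mem (v : V) :
    subgroupSum H ρ v ∈ Representation.invariants (ρ.comp H.subtype) := fun h => by
  change (ρ h * subgroupSum H ρ) v = _
  rw [of_mem_mul_subgroupSum h.2]

theorem heckeOperator_mul_mul {h h' : G} (hh : h ∈ H) (hh' : h' ∈ H) (g : G) :
    heckeOperator H ρ (h * g * h') = heckeOperator H ρ g := by
  calc _ = (subgroupSum H ρ * ρ h) * ρ g * (ρ h' * subgroupSum H ρ) := by
        simp only [heckeOperator, map_mul, mul_assoc]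
    _ = _ := by rw [subgroupSum_mul_of_mem hh, of_mem_mul_subgroupSum hh', heckeOperator]

theorem subgroupSum_mul_self :
    subgroupSum H ρ * subgroupSum H ρ = (Nat.card H : ℂ) • subgroupSum H ρ := by
  ext v
  exact subgroupSum_apply_of_fixed (subgroupSum_apply_mem v)

theorem heckeOperator_mul_heckeOperator (g g' : G) :
    heckeOperator H ρ g * heckeOperator H ρ g' =
      open Classical in (Nat.card H : ℂ) • ∑ h : H, heckeOperator H ρ (g * h * g') := by
  calc _ = subgroupSum H ρ * ρ g * (subgroupSum H ρ * subgroupSum H ρ) * ρ g' *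
        subgroupSum H ρ := by simp only [heckeOperator, mul_assoc]
    _ = (Nat.card H : ℂ) • (subgroupSum H ρ * ρ g * subgroupSum H ρ * ρ g' *
        subgroupSum H ρ) := by simp only [subgroupSum_mul_self, mul_smul_comm, smul_mul_assoc]
    _ = _ := by
        congr 1
        conv_lhs => enter [1, 1, 2]; rw [subgroupSum]
        simp only [Finset.mul_sum, Finset.sum_mul, heckeOperator, map_mul, mul_assoc]

/-- Gelfand's trick: inversion reverses products in the Hecke algebra and fixes its standard basis
when every double coset of `H` is closed under inversion. -/
theorem heckeOperator_commute
    (hsymm : ∀ g : G, ∃ h ∈ H, ∃ h' ∈ H, g⁻¹ = h * g * h') (g g' : G) :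
    heckeOperator H ρ g * heckeOperator H ρ g' = heckeOperator H ρ g' * heckeOperator H ρ g := by
  classical
  have hinv (x : G) : heckeOperator H ρ x⁻¹ = heckeOperator H ρ x := by
    obtain ⟨h, hh, h', hh', hx⟩ := hsymm x
    rw [hx, heckeOperator_mul_mul hh hh']
  rw [heckeOperator_mul_heckeOperator, ← hinv g, ← hinv g', heckeOperator_mul_heckeOperator]
  congr 1
  refine Fintype.sum_equiv (Equiv.inv H) _ _ fun h => ?_
  rw [← hinv]
  simp [mul_assoc]

/-- A nonzero fixed vector generates the space of fixed vectors under the Hecke operators. -/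
theorem mem_span_heckeOperator (hρ : ρ.IsIrreducible) {v w : V} (hv0 : v ≠ 0)
    (hv : v ∈ Representation.invariants (ρ.comp H.subtype))
    (hw : w ∈ Representation.invariants (ρ.comp H.subtype)) :
    w ∈ Submodule.span ℂ (Set.range fun g => heckeOperator H ρ g v) := by
  have hH : (Nat.card H : ℂ) ≠ 0 := by exact_mod_cast Nat.card_pos.ne'
  have hmem : subgroupSum H ρ w ∈
      (Submodule.span ℂ (Set.range fun g => ρ g v)).map (subgroupSum H ρ) :=
    Submodule.mem_map_of_mem (by rw [span_orbit_eq_top hρ hv0]; trivial)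
  rw [Submodule.map_span, subgroupSum_apply_of_fixed hw] at hmem
  have hle : Submodule.span ℂ (subgroupSum H ρ '' Set.range fun g => ρ g v) ≤
      Submodule.span ℂ (Set.range fun g => heckeOperator H ρ g v) := by
    rw [Submodule.span_le]
    rintro _ ⟨_, ⟨g, rfl⟩, rfl⟩
    have hg : heckeOperator H ρ g v = (Nat.card H : ℂ) • subgroupSum H ρ (ρ g v) := by
      simp only [heckeOperator, Module.End.mul_apply, subgroupSum_apply_of_fixed hv, map_smul]
    rw [SetLike.mem_coe, ← inv_smul_smul₀ hH (subgroupSum H ρ (ρ g v)), ← hg]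
    exact Submodule.smul_mem _ _ (Submodule.subset_span ⟨g, rfl⟩)
  rw [← inv_smul_smul₀ hH w]
  exact Submodule.smul_mem _ _ (hle hmem)

/-- By Schur's argument each operator of the commuting family is a scalar on the fixed vectors,
which are therefore all multiples of one of them. -/
theorem finrank_invariants_le_one [FiniteDimensional ℂ V] (hρ : ρ.IsIrreducible)
    (hsymm : ∀ g : G, ∃ h ∈ H, ∃ h' ∈ H, g⁻¹ = h * g * h') :
    Module.finrank ℂ (Representation.invariants (ρ.comp H.subtype)) ≤ 1 := by
  set W := Representation.invariants (ρ.comp H.subtype) with hW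
  rcases subsingleton_or_nontrivial W with hs | hn
  · rw [Module.finrank_zero_of_subsingleton]; exact zero_le_one
  have hscalar (g : G) : ∃ μ : ℂ, ∀ w ∈ W, heckeOperator H ρ g w = μ • w := by
    have hmaps : ∀ w ∈ W, heckeOperator H ρ g w ∈ W := fun w _ => subgroupSum_apply_mem _
    obtain ⟨μ, hμ⟩ := Module.End.exists_eigenvalue ((heckeOperator H ρ g).restrict hmaps)
    obtain ⟨v, hv⟩ := hμ.exists_hasEigenvector
    have hv1 : heckeOperator H ρ g v = μ • (v : V) := congrArg Subtype.val hv.apply_eq_smul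
    have hv0 : (v : V) ≠ 0 := fun h => hv.2 (Subtype.ext h)
    refine ⟨μ, fun w hw => ?_⟩
    have hle : Submodule.span ℂ (Set.range fun g' => heckeOperator H ρ g' v) ≤
        LinearMap.eqLocus (heckeOperator H ρ g) (μ • LinearMap.id) := by
      rw [Submodule.span_le]
      rintro _ ⟨g', rfl⟩
      change (heckeOperator H ρ g * heckeOperator H ρ g') v = μ • heckeOperator H ρ g' v
      rw [heckeOperator_commute hsymm, Module.End.mul_apply, hv1, map_smul]
    exact hle (mem_span_heckeOperator hρ hv0 v.2 hw)
  obtain ⟨v, hv⟩ := exists_ne (0 : W)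
  have hv0 : (v : V) ≠ 0 := fun h => hv (Subtype.ext h)
  refine finrank_le_one v fun w => ?_
  have hle : Submodule.span ℂ (Set.range fun g => heckeOperator H ρ g v) ≤
      Submodule.span ℂ {(v : V)} := by
    rw [Submodule.span_le]
    rintro _ ⟨g, rfl⟩
    obtain ⟨μ, hμ⟩ := hscalar g
    exact Submodule.mem_span_singleton.2 ⟨μ, (hμ v v.2).symm⟩
  obtain ⟨c, hc⟩ := Submodule.mem_span_singleton.1
    (hle (mem_span_heckeOperator hρ hv0 v.2 w.2))
  exact ⟨c, Subtype.ext hc⟩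

end FixedVectors

/-- A subgroup all of whose double cosets are closed under inversion is multiplicity-free. -/
theorem isMultiplicityFree_of_symmetric {G : Type*} [Group G] [Fintype G] {H : Subgroup G}
    (hsymm : ∀ g : G, ∃ h ∈ H, ∃ h' ∈ H, g⁻¹ = h * g * h') : IsMultiplicityFree H := by
  intro V _ _ _ ρ hρ
  rw [charInner_permCharacter]
  have h := finrank_invariants_le_one hρ hsymm
  rcases Nat.le_one_iff_eq_zero_or_eq_one.1 h with h | h <;> simp [h]

/-! ### Two-block partitions and pairs of subsets -/

/-- Two colourings of a finite set with equally large colour classes differ by a permutation. -/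
theorem exists_perm_comp_eq {α β : Type*} [Fintype α] [DecidableEq β] (f f' : α → β)
    (h : ∀ b, (Finset.univ.filter fun a => f a = b).card =
      (Finset.univ.filter fun a => f' a = b).card) :
    ∃ σ : Equiv.Perm α, ∀ a, f' (σ a) = f a :=
  ⟨Equiv.ofFiberEquiv fun b => Fintype.equivOfCardEq (by
    rw [Fintype.card_subtype, Fintype.card_subtype, h]), fun a => Equiv.ofFiberEquiv_map _ a⟩

section Subsets

variable {α : Type*} [DecidableEq α]

theorem image_eq_iff_forall_mem (σ : Equiv.Perm α)
    (B C : Finset α) : B.image σ = C ↔ ∀ i, σ i ∈ C ↔ i ∈ B := by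
  constructor
  · rintro rfl i
    exact σ.injective.mem_finset_image
  · intro h
    ext a
    obtain ⟨a, rfl⟩ := σ.surjective a
    rw [h, σ.injective.mem_finset_image]

variable [Fintype α]

/-- The symmetric group moves one pair of subsets to another as soon as the cardinalities of the
two subsets and of their intersection agree. -/
theorem exists_perm_image_pair {B C B' C' : Finset α} (hB : B.card = B'.card)
    (hC : C.card = C'.card) (hI : (B ∩ C).card = (B' ∩ C').card) :
    ∃ σ : Equiv.Perm α, B.image σ = B' ∧ C.image σ = C' := by
  obtain ⟨σ, hσ⟩ := exists_perm_comp_eq (fun a => (decide (a ∈ B), decide (a ∈ C)))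
    (fun a => (decide (a ∈ B'), decide (a ∈ C'))) (by
      have e1 (X Y : Finset α) : (Finset.univ.filter fun a =>
          (decide (a ∈ X), decide (a ∈ Y)) = (true, true)) = X ∩ Y := by ext; simp
      have e2 (X Y : Finset α) : (Finset.univ.filter fun a =>
          (decide (a ∈ X), decide (a ∈ Y)) = (true, false)) = X \ Y := by ext; simp
      have e3 (X Y : Finset α) : (Finset.univ.filter fun a =>
          (decide (a ∈ X), decide (a ∈ Y)) = (false, true)) = Y \ X := by ext; simp [and_comm]
      have e4 (X Y : Finset α) : (Finset.univ.filter fun a =>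
          (decide (a ∈ X), decide (a ∈ Y)) = (false, false)) = (X ∪ Y)ᶜ := by ext; simp
      have hI' : (C ∩ B).card = (C' ∩ B').card := by
        rwa [Finset.inter_comm C, Finset.inter_comm C']
      have hU : (B ∪ C).card = (B' ∪ C').card := by
        have h1 := Finset.card_union_add_card_inter B C
        have h2 := Finset.card_union_add_card_inter B' C'
        omega
      rintro ⟨_ | _, _ | _⟩
      · rw [e4, e4, Finset.card_compl, Finset.card_compl, hU]
      · have h1 := Finset.card_sdiff_add_card_inter C B
        have h2 := Finset.card_sdiff_add_card_inter C' B'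
        rw [e3, e3]; omega
      · have h1 := Finset.card_sdiff_add_card_inter B C
        have h2 := Finset.card_sdiff_add_card_inter B' C'
        rw [e2, e2]; omega
      · rw [e1, e1, hI])
  have hσ1 (a : α) : (σ a ∈ B' ↔ a ∈ B) ∧ (σ a ∈ C' ↔ a ∈ C) := by simpa using hσ a
  refine ⟨σ, ?_, ?_⟩ <;> ext a <;> obtain ⟨a, rfl⟩ := σ.surjective a
  · rw [(hσ1 a).1, σ.injective.mem_finset_image]
  · rw [(hσ1 a).2, σ.injective.mem_finset_image]

end Subsets

section TwoBlocks

variable {k : ℕ}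

/-- The partition into `B` and its complement. -/
def ofBlock (B : Finset (Fin (2 * k))) (hB : B.card = k) : UniformPartition k :=
  ⟨{B, Bᶜ}, B, Bᶜ, Finset.union_compl B, disjoint_compl_right, hB, by
    rw [Finset.card_compl, hB, Fintype.card_fin]; omega, rfl⟩

theorem card_compl_block {B : Finset (Fin (2 * k))} (hB : B.card = k) : Bᶜ.card = k := by
  rw [Finset.card_compl, hB, Fintype.card_fin]; omega

theorem ofBlock_compl {B : Finset (Fin (2 * k))} (hB : B.card = k) :
    ofBlock Bᶜ (card_compl_block hB) = ofBlock B hB :=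
  Subtype.ext (by simp only [ofBlock, compl_compl]; exact Finset.pair_comm _ _)

theorem exists_eq_ofBlock (P : UniformPartition k) : ∃ B hB, P = ofBlock B hB := by
  obtain ⟨P, B₁, B₂, hu, hd, h₁, h₂, rfl⟩ := P
  have hc : B₂ = B₁ᶜ := (IsCompl.of_eq hd.eq_bot hu).symm.eq_compl
  exact ⟨B₁, h₁, Subtype.ext (by simp only [ofBlock, hc])⟩

/-- Every point lies in a block. -/
theorem exists_eq_ofBlock_mem (P : UniformPartition k) (i : Fin (2 * k)) :
    ∃ B hB, P = ofBlock B hB ∧ i ∈ B := by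
  obtain ⟨B, hB, rfl⟩ := exists_eq_ofBlock P
  by_cases hi : i ∈ B
  · exact ⟨B, hB, rfl, hi⟩
  · exact ⟨Bᶜ, card_compl_block hB, (ofBlock_compl hB).symm, by simpa using hi⟩

theorem smul_ofBlock (σ : Equiv.Perm (Fin (2 * k))) {B C : Finset (Fin (2 * k))} (hB : B.card = k)
    (hC : C.card = k) (h : B.image σ = C) : σ • ofBlock B hB = ofBlock C hC := by
  apply Subtype.ext
  change ({B, Bᶜ} : Finset (Finset (Fin (2 * k)))).image (fun B => B.image σ) = {C, Cᶜ}
  have hc : Bᶜ.image σ = Cᶜ := by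
    rw [image_eq_iff_forall_mem] at h ⊢
    intro i
    rw [Finset.mem_compl, Finset.mem_compl, h]
  rw [Finset.image_insert, Finset.image_singleton, h, hc]

theorem ofBlock_eq_iff {B C : Finset (Fin (2 * k))} (hB : B.card = k) (hC : C.card = k) :
    ofBlock B hB = ofBlock C hC ↔ B = C ∨ B = Cᶜ := by
  constructor
  · intro h
    have hm : B ∈ (ofBlock C hC).1 := by rw [← h]; simp [ofBlock]
    simpa [ofBlock] using hm
  · rintro (rfl | rfl)
    · rfl
    · exact ofBlock_compl hC

theorem isPretransitive_uniformPartition :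
    MulAction.IsPretransitive (Equiv.Perm (Fin (2 * k))) (UniformPartition k) := by
  refine ⟨fun P Q => ?_⟩
  obtain ⟨B, hB, rfl⟩ := exists_eq_ofBlock P
  obtain ⟨C, hC, rfl⟩ := exists_eq_ofBlock Q
  obtain ⟨σ, h, -⟩ := exists_perm_image_pair (B := B) (C := ∅) (B' := C) (C' := ∅)
    (by rw [hB, hC]) rfl (by simp)
  exact ⟨σ, smul_ofBlock σ hB hC h⟩

/-- The orbitals of the symmetric group on two-block partitions are symmetric. -/
theorem exists_perm_swap (P Q : UniformPartition k) :
    ∃ σ : Equiv.Perm (Fin (2 * k)), σ • P = Q ∧ σ • Q = P := by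
  obtain ⟨B, hB, rfl⟩ := exists_eq_ofBlock P
  obtain ⟨C, hC, rfl⟩ := exists_eq_ofBlock Q
  obtain ⟨σ, h1, h2⟩ := exists_perm_image_pair (B := B) (C := C) (B' := C) (C' := B)
    (by rw [hB, hC]) (by rw [hB, hC]) (by rw [Finset.inter_comm])
  exact ⟨σ, smul_ofBlock σ hB hC h1, smul_ofBlock σ hC hB h2⟩

/-- The first block of `basePartition k`. -/
def firstBlock (k : ℕ) : Finset (Fin (2 * k)) :=
  Finset.univ.filter fun i : Fin (2 * k) => (i : ℕ) < k

@[simp]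
theorem mem_firstBlock {i : Fin (2 * k)} : i ∈ firstBlock k ↔ (i : ℕ) < k := by
  simp [firstBlock]

theorem card_firstBlock : (firstBlock k).card = k := by
  rw [firstBlock, Fin.card_filter_val_lt]; omega

theorem basePartition_eq_ofBlock : basePartition k = ofBlock (firstBlock k) card_firstBlock :=
  Subtype.ext (by
    simp only [basePartition, ofBlock, firstBlock, Finset.compl_filter])

/-- A permutation stabilizes the base partition iff it preserves or exchanges its blocks. -/
theorem mem_stabilizer_basePartition (σ : Equiv.Perm (Fin (2 * k))) :
    σ ∈ MulAction.stabilizer (Equiv.Perm (Fin (2 * k))) (basePartition k) ↔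
      (∀ i, ((σ i : ℕ) < k ↔ (i : ℕ) < k)) ∨ ∀ i, (¬ (σ i : ℕ) < k ↔ (i : ℕ) < k) := by
  rw [MulAction.mem_stabilizer_iff, basePartition_eq_ofBlock,
    smul_ofBlock σ card_firstBlock (C := (firstBlock k).image σ)
      (by rw [Finset.card_image_of_injective _ σ.injective, card_firstBlock]) rfl,
    ofBlock_eq_iff, image_eq_iff_forall_mem, image_eq_iff_forall_mem]
  simp

theorem finProdFinEquiv_lt_iff (a : Fin 2) (b : Fin k) :
    ((finProdFinEquiv (a, b) : Fin (2 * k)) : ℕ) < k ↔ a = 0 := by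
  have hb := b.2
  fin_cases a <;> simp [finProdFinEquiv]

theorem fst_eq_zero_iff (i : Fin (2 * k)) :
    (finProdFinEquiv.symm i : Fin 2 × Fin k).1 = 0 ↔ (i : ℕ) < k := by
  rw [← finProdFinEquiv_lt_iff, Prod.mk.eta, Equiv.apply_symm_apply]

/-- A permutation that acts on the set of blocks through `τ` belongs to the wreath product. -/
theorem mem_wreathSym_of_fst {m : ℕ} (σ : Equiv.Perm (Fin (m * k))) (τ : Equiv.Perm (Fin m))
    (h : ∀ a b, (finProdFinEquiv.symm (σ (finProdFinEquiv (a, b))) : Fin m × Fin k).1 = τ a) :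
    σ ∈ wreathSym k m := by
  have hinj (a : Fin m) : Function.Injective fun b : Fin k =>
      (finProdFinEquiv.symm (σ (finProdFinEquiv (a, b))) : Fin m × Fin k).2 := by
    intro b b' hb
    have he : (finProdFinEquiv.symm (σ (finProdFinEquiv (a, b))) : Fin m × Fin k) =
        finProdFinEquiv.symm (σ (finProdFinEquiv (a, b'))) :=
      Prod.ext (by rw [h, h]) hb
    exact (Prod.mk.inj
      (finProdFinEquiv.injective (σ.injective (finProdFinEquiv.symm.injective he)))).2
  refine ⟨τ, fun a => Equiv.ofBijective _ (Finite.injective_iff_bijective.1 (hinj a)),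
    fun a b => ?_⟩
  rw [Equiv.ofBijective_apply, ← h a b, Prod.mk.eta, Equiv.apply_symm_apply]

theorem stabilizer_basePartition :
    MulAction.stabilizer (Equiv.Perm (Fin (2 * k))) (basePartition k) = wreathSym k 2 := by
  ext σ
  rw [mem_stabilizer_basePartition]
  have hfin (a c : Fin 2) : (a = 0 ↔ c = 0) → a = c := by revert a c; decide
  constructor
  · rintro (h | h)
    · refine mem_wreathSym_of_fst σ 1 fun a b => hfin _ _ ?_
      rw [fst_eq_zero_iff, h, finProdFinEquiv_lt_iff, Equiv.Perm.one_apply]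
    · refine mem_wreathSym_of_fst σ (Equiv.swap 0 1) fun a b => hfin _ _ ?_
      have h1 := h (finProdFinEquiv (a, b))
      rw [finProdFinEquiv_lt_iff] at h1
      rw [fst_eq_zero_iff, ← not_iff_not, h1]
      clear h1
      revert a; decide
  · rintro ⟨τ, f, h⟩
    have h0 : τ 0 = 0 ∧ τ 1 = 1 ∨ τ 0 = 1 ∧ τ 1 = 0 := by clear h; revert τ; decide
    refine h0.imp ?_ ?_ <;> rintro ⟨h0, h1⟩ i <;>
      obtain ⟨⟨a, b⟩, rfl⟩ := finProdFinEquiv.surjective i <;>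
      rw [h, finProdFinEquiv_lt_iff, finProdFinEquiv_lt_iff] <;>
      fin_cases a <;> simp [h0, h1]

/-- Double cosets of the wreath product are closed under inversion. -/
theorem exists_inv_eq_mul_mul (g : Equiv.Perm (Fin (2 * k))) :
    ∃ h ∈ wreathSym k 2, ∃ h' ∈ wreathSym k 2, g⁻¹ = h * g * h' := by
  rw [← stabilizer_basePartition]
  obtain ⟨σ, h1, h2⟩ := exists_perm_swap (basePartition k) (g • basePartition k)
  refine ⟨g⁻¹ * σ, ?_, g⁻¹ * σ⁻¹, ?_, by group⟩
  · rw [MulAction.mem_stabilizer_iff, mul_smul, h1, inv_smul_smul]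
  · rw [MulAction.mem_stabilizer_iff, mul_smul, inv_smul_eq_iff, inv_smul_eq_iff, h2]

end TwoBlocks

/-! ### Tableaux with at most two rows -/

section Tableaux

variable {n : ℕ} {p : n.Partition} {a b : ℕ}

theorem partialSum_of_parts_pair (hp : p.parts = {a, b}) (hab : b ≤ a) (j : ℕ) :
    partialSum p j = if j = 0 then 0 else if j = 1 then a else a + b := by
  have hsort : p.parts.sort (· ≥ ·) = [a, b] := by
    rw [hp, Multiset.insert_eq_cons, Multiset.sort_cons _ _ _ (by simpa using hab),
      Multiset.sort_singleton]
  rw [partialSum, hsort]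
  rcases j with _ | _ | j <;> simp

theorem row_of_parts_pair (hp : p.parts = {a, b}) (hab : b ≤ a) (i : Fin n) :
    row p i = if (i : ℕ) < a then 0 else 1 := by
  have hn : a + b = n := by rw [← p.parts_sum, hp]; simp
  have hi := i.2
  have hfilter : (Finset.range (Multiset.card p.parts)).filter
      (fun j => partialSum p (j + 1) ≤ (i : ℕ)) = if (i : ℕ) < a then ∅ else {0} := by
    ext j
    rw [Finset.mem_filter, Finset.mem_range, partialSum_of_parts_pair hp hab, hp]
    rcases j with _ | j <;> split_ifs <;> simp_all
  rw [row, hfilter]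
  split_ifs <;> rfl

theorem col_of_parts_pair (hp : p.parts = {a, b}) (hab : b ≤ a) (i : Fin n) :
    col p i = if (i : ℕ) < a then (i : ℕ) else i - a := by
  rw [col, row_of_parts_pair hp hab, partialSum_of_parts_pair hp hab]
  split_ifs <;> simp_all

/-- The Young subgroup of a partition with two parts is the set stabilizer of its first row. -/
theorem mem_youngSubgroup_of_parts_pair (hp : p.parts = {a, b}) (hab : b ≤ a)
    (σ : Equiv.Perm (Fin n)) :
    σ ∈ youngSubgroup p ↔ ∀ i, ((σ i : ℕ) < a ↔ (i : ℕ) < a) := by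
  refine forall_congr' fun i => ?_
  rw [row_of_parts_pair hp hab, row_of_parts_pair hp hab]
  split_ifs with h1 h2 h2 <;> simp [h1, h2]

theorem partialSum_of_parts_singleton (hp : p.parts = {n}) (j : ℕ) :
    partialSum p j = if j = 0 then 0 else n := by
  rw [partialSum, hp, Multiset.sort_singleton]
  rcases j with _ | j <;> simp

theorem row_of_parts_singleton (hp : p.parts = {n}) (i : Fin n) : row p i = 0 := by
  rw [row, Finset.card_eq_zero, Finset.filter_eq_empty_iff]
  intro j _
  rw [partialSum_of_parts_singleton hp]
  simp

theorem col_of_parts_singleton (hp : p.parts = {n}) (i : Fin n) : col p i = i := by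
  rw [col, row_of_parts_singleton hp, partialSum_of_parts_singleton hp]
  simp

end Tableaux

/-! ### Orbits of Young subgroups with two factors -/

section YoungOrbits

variable {k : ℕ}

/-- If two blocks of size `k` meet the second row in equally many points, then the Young subgroup
maps one to the other. -/
theorem exists_mem_youngSubgroup_smul_eq {p : (2 * k).Partition} {a b : ℕ} (hp : p.parts = {a, b})
    (hab : b ≤ a) {B C : Finset (Fin (2 * k))} (hB : B.card = k) (hC : C.card = k)
    (hI : (B ∩ Finset.univ.filter fun i => ¬ (i : ℕ) < a).card =
      (C ∩ Finset.univ.filter fun i => ¬ (i : ℕ) < a).card) :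
    ∃ σ ∈ youngSubgroup p, σ • ofBlock B hB = ofBlock C hC := by
  obtain ⟨σ, h1, h2⟩ := exists_perm_image_pair (hB.trans hC.symm) rfl hI
  refine ⟨σ, ?_, smul_ofBlock σ hB hC h1⟩
  rw [mem_youngSubgroup_of_parts_pair hp hab]
  rw [image_eq_iff_forall_mem] at h2
  intro i
  have h := h2 i
  rw [Finset.mem_filter, Finset.mem_filter] at h
  simpa only [Finset.mem_univ, true_and, not_iff_not] using h

/-- The stabilizer of the last point is transitive on the two-block partitions. -/
theorem exists_mem_youngSubgroup_smul_eq_of_hook {p : (2 * k).Partition} (hk : 3 ≤ k)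
    (hp : p.parts = {2 * k - 1, 1}) (P Q : UniformPartition k) :
    ∃ σ ∈ youngSubgroup p, σ • P = Q := by
  obtain ⟨B, hB, rfl, hiB⟩ := exists_eq_ofBlock_mem P ⟨2 * k - 1, by omega⟩
  obtain ⟨C, hC, rfl, hiC⟩ := exists_eq_ofBlock_mem Q ⟨2 * k - 1, by omega⟩
  refine exists_mem_youngSubgroup_smul_eq hp (by omega) hB hC ?_
  have hD : (Finset.univ.filter fun i : Fin (2 * k) => ¬ (i : ℕ) < 2 * k - 1) =
      {⟨2 * k - 1, by omega⟩} := by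
    ext i
    have := i.2
    simp only [Finset.mem_filter, Finset.mem_univ, true_and, Finset.mem_singleton, Fin.ext_iff]
    omega
  rw [hD, Finset.inter_singleton_of_mem hiB, Finset.inter_singleton_of_mem hiC]

theorem eq_or_eq_of_le_val (hk : 3 ≤ k) {i : Fin (2 * k)} (hi : 2 * k - 2 ≤ (i : ℕ)) :
    i = ⟨2 * k - 1, by omega⟩ ∨ i = ⟨2 * k - 2, by omega⟩ := by
  simp only [Fin.ext_iff]
  omega

/-- For a block `B` with the last point, the partition into `B` and its complement has the last
two points together iff the last but one point is in `B` as well. -/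
theorem ofBlock_mem_lastTwoTogether (hk : 3 ≤ k) {B : Finset (Fin (2 * k))} (hB : B.card = k)
    (hl : (⟨2 * k - 1, by omega⟩ : Fin (2 * k)) ∈ B) :
    ofBlock B hB ∈ lastTwoTogether k ↔ (⟨2 * k - 2, by omega⟩ : Fin (2 * k)) ∈ B := by
  constructor
  · rintro ⟨C, hC, h⟩
    have hC' : C = B ∨ C = Bᶜ := by simpa [ofBlock] using hC
    rcases hC' with rfl | rfl
    · exact h _ le_rfl
    · exact absurd hl (Finset.mem_compl.1 (h _ (by simp only; omega)))
  · intro h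
    refine ⟨B, by simp [ofBlock], fun i hi => ?_⟩
    rcases eq_or_eq_of_le_val hk hi with hi' | hi' <;> rw [hi']
    exacts [hl, h]

theorem exists_mem_youngSubgroup_partitionTwo_smul_eq (hk : 3 ≤ k) {P Q : UniformPartition k}
    (h : P ∈ lastTwoTogether k ↔ Q ∈ lastTwoTogether k) :
    ∃ σ ∈ youngSubgroup (partitionTwo k hk), σ • P = Q := by
  obtain ⟨B, hB, rfl, hiB⟩ := exists_eq_ofBlock_mem P ⟨2 * k - 1, by omega⟩
  obtain ⟨C, hC, rfl, hiC⟩ := exists_eq_ofBlock_mem Q ⟨2 * k - 1, by omega⟩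
  rw [ofBlock_mem_lastTwoTogether hk hB hiB, ofBlock_mem_lastTwoTogether hk hC hiC] at h
  refine exists_mem_youngSubgroup_smul_eq rfl (by omega) hB hC ?_
  congr 1
  ext i
  simp only [Finset.mem_inter, Finset.mem_filter, Finset.mem_univ, true_and]
  refine and_congr_left fun hi => ?_
  rcases eq_or_eq_of_le_val hk (not_lt.1 hi) with hi' | hi' <;> rw [hi']
  exacts [iff_of_true hiB hiC, h]

theorem smul_mem_lastTwoTogether (hk : 3 ≤ k) {σ : Equiv.Perm (Fin (2 * k))}
    (hσ : σ ∈ youngSubgroup (partitionTwo k hk)) {P : UniformPartition k}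
    (hP : P ∈ lastTwoTogether k) : σ • P ∈ lastTwoTogether k := by
  have hσ' := (mem_youngSubgroup_of_parts_pair rfl (by omega) _).1 (inv_mem hσ)
  obtain ⟨B, hB, h⟩ := hP
  refine ⟨B.image σ, Finset.mem_image_of_mem _ hB, fun i hi => ?_⟩
  refine Finset.mem_image.2 ⟨σ⁻¹ i, h _ ?_, by simp⟩
  have := hσ' i
  omega

theorem smul_mem_lastTwoTogether_iff (hk : 3 ≤ k) {σ : Equiv.Perm (Fin (2 * k))}
    (hσ : σ ∈ youngSubgroup (partitionTwo k hk)) (P : UniformPartition k) :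
    σ • P ∈ lastTwoTogether k ↔ P ∈ lastTwoTogether k := by
  refine ⟨fun h => ?_, smul_mem_lastTwoTogether hk hσ⟩
  simpa using smul_mem_lastTwoTogether hk (inv_mem hσ) h

theorem orbit_youngSubgroup_partitionTwo (hk : 3 ≤ k) (P : UniformPartition k) :
    MulAction.orbit (youngSubgroup (partitionTwo k hk)) P =
      {Q | Q ∈ lastTwoTogether k ↔ P ∈ lastTwoTogether k} := by
  ext Q
  constructor
  · rintro ⟨σ, rfl⟩
    exact smul_mem_lastTwoTogether_iff hk σ.2 P
  · intro h
    obtain ⟨σ, hσ, h⟩ := exists_mem_youngSubgroup_partitionTwo_smul_eq hk (Iff.symm h)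
    exact ⟨⟨σ, hσ⟩, h⟩

/-- For `k ≥ 3`, two partitions `{B, Bᶜ}` and `{C, Cᶜ}` can be written so that `B ∩ C` has at least
two elements; then `Bᶜ ∩ Cᶜ` is nonempty as well. -/
theorem exists_blocks_inter (hk : 3 ≤ k) (P Q : UniformPartition k) :
    ∃ B hB C hC, P = ofBlock B hB ∧ Q = ofBlock C hC ∧
      1 < (B ∩ C).card ∧ (Bᶜ ∩ Cᶜ).Nonempty := by
  obtain ⟨B, hB, rfl⟩ := exists_eq_ofBlock P
  have key (C : Finset (Fin (2 * k))) (hC : C.card = k) (h : k ≤ 2 * (B ∩ C).card) :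
      1 < (B ∩ C).card ∧ (Bᶜ ∩ Cᶜ).Nonempty := by
    refine ⟨by omega, ?_⟩
    rw [← Finset.card_pos, ← Finset.compl_union, Finset.card_compl, Fintype.card_fin]
    have := Finset.card_union_add_card_inter B C
    omega
  obtain ⟨C, hC, rfl⟩ := exists_eq_ofBlock Q
  have hsum : (B ∩ C).card + (B ∩ Cᶜ).card = k := by
    rw [← Finset.sdiff_eq_inter_compl, Finset.card_inter_add_card_sdiff, hB]
  rcases le_total k (2 * (B ∩ C).card) with h | h
  · exact ⟨B, hB, C, hC, rfl, rfl, key C hC h⟩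
  · exact ⟨B, hB, Cᶜ, card_compl_block hC, rfl, (ofBlock_compl hC).symm,
      key Cᶜ (card_compl_block hC) (by omega)⟩

theorem exists_perm_apply_eq_of_ne {α : Type*} [Fintype α] [DecidableEq α] {a b c d : α}
    (hab : a ≠ b) (hcd : c ≠ d) : ∃ σ : Equiv.Perm α, σ a = c ∧ σ b = d := by
  obtain ⟨σ, h1, h2⟩ := exists_perm_image_pair (B := {a}) (C := {b}) (B' := {c}) (C' := {d})
    rfl rfl (by simp [hab, hcd])
  exact ⟨σ, by simpa using h1, by simpa using h2⟩

/-- Every orbital contains a pair of partitions with the last two points together and a pair of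
partitions with the last two points apart. -/
theorem exists_smul_mem_lastTwoTogether (hk : 3 ≤ k) (P Q : UniformPartition k) :
    (∃ σ : Equiv.Perm (Fin (2 * k)), σ • P ∈ lastTwoTogether k ∧ σ • Q ∈ lastTwoTogether k) ∧
    ∃ σ : Equiv.Perm (Fin (2 * k)), σ • P ∉ lastTwoTogether k ∧ σ • Q ∉ lastTwoTogether k := by
  obtain ⟨B, hB, C, hC, rfl, rfl, h1, ⟨c, hc⟩⟩ := exists_blocks_inter hk P Q
  obtain ⟨a, ha, b, hb, hab⟩ := Finset.one_lt_card.1 h1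
  rw [Finset.mem_inter] at ha hb hc
  rw [Finset.mem_compl, Finset.mem_compl] at hc
  have hne : (⟨2 * k - 2, by omega⟩ : Fin (2 * k)) ≠ ⟨2 * k - 1, by omega⟩ := by
    simp only [ne_eq, Fin.ext_iff]; omega
  have hmem (σ : Equiv.Perm (Fin (2 * k))) {x y : Fin (2 * k)} {D : Finset (Fin (2 * k))}
      (hD : D.card = k) (hy : y ∈ D) (hσx : σ x = ⟨2 * k - 2, by omega⟩)
      (hσy : σ y = ⟨2 * k - 1, by omega⟩) : σ • ofBlock D hD ∈ lastTwoTogether k ↔ x ∈ D := by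
    rw [smul_ofBlock σ hD (by rwa [Finset.card_image_of_injective _ σ.injective]) rfl,
      ofBlock_mem_lastTwoTogether hk _ (by rw [← hσy]; exact Finset.mem_image_of_mem _ hy),
      ← hσx, σ.injective.mem_finset_image]
  have hcb : c ≠ b := fun h => hc.1 (h ▸ hb.1)
  obtain ⟨σ, h1, h2⟩ := exists_perm_apply_eq_of_ne hab hne
  obtain ⟨τ, h3, h4⟩ := exists_perm_apply_eq_of_ne hcb hne
  refine ⟨⟨σ, ?_, ?_⟩, ⟨τ, ?_, ?_⟩⟩
  · rw [hmem σ hB hb.1 h1 h2]; exact ha.1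
  · rw [hmem σ hC hb.2 h1 h2]; exact ha.2
  · rw [hmem τ hB hb.1 h3 h4]; exact hc.1
  · rw [hmem τ hC hb.2 h3 h4]; exact hc.2

theorem exists_mem_and_exists_notMem_lastTwoTogether (hk : 3 ≤ k) :
    (∃ P, P ∈ lastTwoTogether k) ∧ ∃ P, P ∉ lastTwoTogether k := by
  obtain ⟨⟨σ, h, -⟩, ⟨τ, h', -⟩⟩ :=
    exists_smul_mem_lastTwoTogether hk (basePartition k) (basePartition k)
  exact ⟨⟨_, h⟩, ⟨_, h'⟩⟩

theorem isOrbit_youngSubgroup_partitionTwo (hk : 3 ≤ k) (T : Set (UniformPartition k)) :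
    IsOrbit (youngSubgroup (partitionTwo k hk)) T ↔
      T = lastTwoTogether k ∨ T = (lastTwoTogether k)ᶜ := by
  have h1 {P : UniformPartition k} (hP : P ∈ lastTwoTogether k) :
      MulAction.orbit (youngSubgroup (partitionTwo k hk)) P = lastTwoTogether k := by
    rw [orbit_youngSubgroup_partitionTwo]; ext Q; simp [hP]
  have h2 {P : UniformPartition k} (hP : P ∉ lastTwoTogether k) :
      MulAction.orbit (youngSubgroup (partitionTwo k hk)) P = (lastTwoTogether k)ᶜ := by
    rw [orbit_youngSubgroup_partitionTwo]; ext Q; simp [hP]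
  obtain ⟨⟨P, hP⟩, ⟨Q, hQ⟩⟩ := exists_mem_and_exists_notMem_lastTwoTogether hk
  constructor
  · rintro ⟨R, rfl⟩
    by_cases hR : R ∈ lastTwoTogether k
    · exact Or.inl (h1 hR)
    · exact Or.inr (h2 hR)
  · rintro (rfl | rfl)
    · exact ⟨P, (h1 hP).symm⟩
    · exact ⟨Q, (h2 hQ).symm⟩

theorem not_isCoclique_lastTwoTogether (hk : 3 ≤ k)
    {O : Set (UniformPartition k × UniformPartition k)}
    (hO : IsOrbital (Equiv.Perm (Fin (2 * k))) O) :
    ¬ IsCoclique O (lastTwoTogether k) ∧ ¬ IsCoclique O (lastTwoTogether k)ᶜ := by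
  obtain ⟨⟨P, Q⟩, rfl⟩ := hO
  obtain ⟨⟨σ, h1, h2⟩, ⟨τ, h3, h4⟩⟩ := exists_smul_mem_lastTwoTogether hk P Q
  exact ⟨fun h => h _ h1 _ h2 ⟨σ, rfl⟩, fun h => h _ h3 _ h4 ⟨τ, rfl⟩⟩

end YoungOrbits

/-- Cocliques of orbital graphs that are orbits of a subgroup correspond under the identification
of a coset space with an orbit. -/
theorem not_isCoclique_quotient {G X : Type*} [Group G] [MulAction G X] {x : X} {H : Subgroup G}
    (hH : MulAction.stabilizer G x = H) (K : Subgroup G)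
    (hX : ∀ (T : Set X) (O : Set (X × X)), IsOrbit K T → IsOrbital G O → ¬ IsCoclique O T)
    (S : Set (G ⧸ H)) (hS : IsOrbit K S) : ¬ ∃ O, IsOrbital G O ∧ IsCoclique O S := by
  subst hH
  obtain ⟨s, rfl⟩ := hS
  rintro ⟨_, ⟨⟨a, b⟩, rfl⟩, hc⟩
  set f := MulAction.ofQuotientStabilizer G x with hf
  have hsmul (g : G) (y : G ⧸ MulAction.stabilizer G x) : f (g • y) = g • f y :=
    MulAction.ofQuotientStabilizer_smul G x g y
  have hinj : Function.Injective f := MulAction.injective_ofQuotientStabilizer G x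
  refine hX (MulAction.orbit K (f s)) (MulAction.orbit G (f a, f b)) ⟨_, rfl⟩ ⟨_, rfl⟩ ?_
  rintro _ ⟨κ, rfl⟩ _ ⟨κ', rfl⟩ ⟨g, hg⟩
  have h1 : g • f a = (κ : G) • f s := congrArg Prod.fst hg
  have h2 : g • f b = (κ' : G) • f s := congrArg Prod.snd hg
  rw [← hsmul, ← hsmul] at h1 h2
  exact hc (κ • s) ⟨κ, rfl⟩ (κ' • s) ⟨κ', rfl⟩ ⟨g, Prod.ext (hinj h1) (hinj h2)⟩

/-! ### Fixed vectors in Specht modules -/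

section Specht

variable {n : ℕ} {p : n.Partition}

theorem coe_spechtRep_apply (g : Equiv.Perm (Fin n)) (x : spechtModule p) :
    ((spechtRep p g x : spechtModule p) : MonoidAlgebra ℂ (Equiv.Perm (Fin n))) =
      MonoidAlgebra.single g 1 * x.1 := by
  simp [spechtRep, Representation.ofModule']

/-- The coefficients of an element of the Specht module are constant on the left cosets of the
Young subgroup. -/
theorem coeff_mul_of_mem_youngSubgroup (x : spechtModule p) (g : Equiv.Perm (Fin n))
    {s : Equiv.Perm (Fin n)} (hs : s ∈ youngSubgroup p) :
    x.1.coeff (g * s) = x.1.coeff g := by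
  classical
  obtain ⟨y, hy⟩ := Ideal.mem_span_singleton'.1 x.2
  have hc : youngSymmetrizer p * MonoidAlgebra.single s⁻¹ 1 = youngSymmetrizer p := by
    rw [youngSymmetrizer, mul_assoc]
    congr 1
    rw [Finset.sum_mul]
    refine Fintype.sum_equiv (Equiv.mulRight s⁻¹) _ _ fun σ => ?_
    simp only [Equiv.coe_mulRight, Subgroup.mul_mem_cancel_right _ (inv_mem hs)]
    split_ifs <;> simp
  have hx : x.1 * MonoidAlgebra.single s⁻¹ 1 = x.1 := by rw [← hy, mul_assoc, hc]
  conv_rhs => rw [← hx]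
  simp

/-- An odd column permutation forces the coefficients of each element of the Specht module to sum
to zero. -/
theorem sum_coeff_eq_zero {τ : Equiv.Perm (Fin n)} (hτ : τ ∈ columnSubgroup p)
    (hsign : Equiv.Perm.sign τ = -1) (x : spechtModule p) : ∑ g, x.1.coeff g = 0 := by
  classical
  let ε := MonoidAlgebra.lift ℂ ℂ (Equiv.Perm (Fin n)) 1
  obtain ⟨y, hy⟩ := Ideal.mem_span_singleton'.1 x.2
  have hε (z : MonoidAlgebra ℂ (Equiv.Perm (Fin n))) : ε z = ∑ g, z.coeff g := by
    simp only [ε, MonoidAlgebra.lift_apply]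
    rw [Finsupp.sum_fintype _ _ (by simp)]
    simp
  have hb : ε (∑ σ : Equiv.Perm (Fin n), if σ ∈ columnSubgroup p then
      MonoidAlgebra.single σ (((Equiv.Perm.sign σ : ℤˣ) : ℤ) : ℂ) else 0) = 0 := by
    rw [map_sum, ← CharZero.eq_neg_self_iff, ← Finset.sum_neg_distrib]
    refine Fintype.sum_equiv (Equiv.mulRight τ) _ _ fun σ => ?_
    simp only [Equiv.coe_mulRight, Subgroup.mul_mem_cancel_right _ hτ]
    split_ifs <;> simp [ε, hsign]
  rw [← hε, ← hy, map_mul, youngSymmetrizer, map_mul, hb, zero_mul, mul_zero]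

theorem coeff_mul_of_mem_invariants {H : Subgroup (Equiv.Perm (Fin n))} {x : spechtModule p}
    (hx : x ∈ Representation.invariants ((spechtRep p).comp H.subtype))
    {h : Equiv.Perm (Fin n)} (hh : h ∈ H) (g : Equiv.Perm (Fin n)) :
    x.1.coeff (h * g) = x.1.coeff g := by
  have h1 : spechtRep p h⁻¹ x = x := hx ⟨h⁻¹, inv_mem hh⟩
  conv_rhs => rw [← h1, coe_spechtRep_apply]
  simp

/-- The projection of the Young symmetrizer to the `H`-fixed vectors has a positive coefficient at
the identity if only even column permutations contribute to that coefficient. -/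
theorem exists_mem_invariants_ne_zero {H : Subgroup (Equiv.Perm (Fin n))}
    (hsign : ∀ h ∈ H, ∀ σ ∈ columnSubgroup p, ∀ s ∈ youngSubgroup p, h * σ * s = 1 →
      Equiv.Perm.sign σ = 1) :
    ∃ x ∈ Representation.invariants ((spechtRep p).comp H.subtype), x ≠ 0 := by
  classical
  refine ⟨_, subgroupSum_apply_mem ⟨youngSymmetrizer p, Ideal.mem_span_singleton_self _⟩,
    fun h0 => ?_⟩
  set x := subgroupSum H (spechtRep p) ⟨youngSymmetrizer p, Ideal.mem_span_singleton_self _⟩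
  have hx : x.1 = ∑ h : H, MonoidAlgebra.single (h : Equiv.Perm (Fin n)) 1 *
      youngSymmetrizer p := by
    simp only [x, subgroupSum, LinearMap.sum_apply, AddSubmonoidClass.coe_finsetSum,
      coe_spechtRep_apply]
  have hcoeff : x.1.coeff 1 = ((∑ h : H, ∑ σ : Equiv.Perm (Fin n), ∑ s : Equiv.Perm (Fin n),
      if (h : Equiv.Perm (Fin n)) * σ * s = 1 ∧ σ ∈ columnSubgroup p ∧ s ∈ youngSubgroup p
        then 1 else 0 : ℕ) : ℂ) := by
    rw [hx]
    simp only [youngSymmetrizer, Finset.sum_mul_sum]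
    simp only [Finset.mul_sum, MonoidAlgebra.coeff_sum,
      Finsupp.finsetSum_apply, Nat.cast_sum]
    refine Finset.sum_congr rfl fun h _ => Finset.sum_congr rfl fun σ _ =>
      Finset.sum_congr rfl fun s _ => ?_
    by_cases hσ : σ ∈ columnSubgroup p
    · by_cases hs : s ∈ youngSubgroup p
      · by_cases he : (h : Equiv.Perm (Fin n)) * σ * s = 1
        · have h1 := hsign h h.2 σ hσ s hs he
          simp [hσ, hs, he, h1, MonoidAlgebra.single_mul_single, ← mul_assoc]
        · simp [hσ, hs, he, MonoidAlgebra.single_mul_single, ← mul_assoc]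
      · simp [hs]
    · simp [hσ]
  have hpos : (0 : ℕ) < ∑ h : H, ∑ σ : Equiv.Perm (Fin n), ∑ s : Equiv.Perm (Fin n),
      if (h : Equiv.Perm (Fin n)) * σ * s = 1 ∧ σ ∈ columnSubgroup p ∧ s ∈ youngSubgroup p
        then 1 else 0 := by
    refine Finset.sum_pos' (fun _ _ => Nat.zero_le _) ⟨1, Finset.mem_univ _, ?_⟩
    refine Finset.sum_pos' (fun _ _ => Nat.zero_le _) ⟨1, Finset.mem_univ _, ?_⟩
    refine Finset.sum_pos' (fun _ _ => Nat.zero_le _) ⟨1, Finset.mem_univ _, ?_⟩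
    simp [one_mem]
  rw [h0, ZeroMemClass.coe_zero, MonoidAlgebra.coeff_zero, Finsupp.zero_apply] at hcoeff
  exact hpos.ne' (by exact_mod_cast hcoeff.symm)

/-- The fixed space is a line if it is nonzero and an element of it vanishes as soon as its
coefficient at `g₀` does. -/
theorem mem_Lam_of_coeff {H : Subgroup (Equiv.Perm (Fin n))}
    (hsign : ∀ h ∈ H, ∀ σ ∈ columnSubgroup p, ∀ s ∈ youngSubgroup p, h * σ * s = 1 →
      Equiv.Perm.sign σ = 1)
    (g₀ : Equiv.Perm (Fin n))
    (hinj : ∀ x ∈ Representation.invariants ((spechtRep p).comp H.subtype),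
      x.1.coeff g₀ = 0 → ∀ g, x.1.coeff g = 0) : p ∈ Lam H := by
  change charInner (permCharacter H) (spechtRep p).character = 1
  rw [charInner_permCharacter]
  obtain ⟨v, hv, hv0⟩ := exists_mem_invariants_ne_zero hsign
  have hval {x : spechtModule p} (h : ∀ g, x.1.coeff g = 0) : x = 0 :=
    Subtype.ext (MonoidAlgebra.ext (Finsupp.ext h))
  have hc : v.1.coeff g₀ ≠ 0 := fun h => hv0 (hval (hinj v hv h))
  have hrank : Module.finrank ℂ (Representation.invariants ((spechtRep p).comp H.subtype)) = 1 := by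
    refine finrank_eq_one (⟨v, hv⟩ : Representation.invariants ((spechtRep p).comp H.subtype))
      (fun h => hv0 (congrArg Subtype.val h)) fun w => ⟨w.1.1.coeff g₀ / v.1.coeff g₀, ?_⟩
    have hz := hinj _ ((w.1.1.coeff g₀ / v.1.coeff g₀) • (⟨v, hv⟩ :
      Representation.invariants ((spechtRep p).comp H.subtype)) - w).2 (by
        simp [hc])
    exact sub_eq_zero.1 (Subtype.ext (hval hz))
  rw [hrank, Nat.cast_one]

theorem notMem_Lam_of_coeff {H : Subgroup (Equiv.Perm (Fin n))}
    (hzero : ∀ x ∈ Representation.invariants ((spechtRep p).comp H.subtype),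
      ∀ g, x.1.coeff g = 0) : p ∉ Lam H := by
  intro hp
  change charInner (permCharacter H) (spechtRep p).character = 1 at hp
  rw [charInner_permCharacter] at hp
  have hbot : Representation.invariants ((spechtRep p).comp H.subtype) = ⊥ :=
    (Submodule.eq_bot_iff _).2 fun x hx =>
      Subtype.ext (MonoidAlgebra.ext (Finsupp.ext (hzero x hx)))
  rw [hbot, finrank_bot] at hp
  simp at hp

end Specht

/-! ### The members of `Lam` with a long first row -/

section Wreath

variable {k : ℕ}

/-- A fixed vector in a Specht module is a function on two-block partitions that is constant on the
orbits of the Young subgroup. -/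
theorem coeff_eq_of_smul_eq {p : (2 * k).Partition} {x : spechtModule p}
    (hx : x ∈ Representation.invariants ((spechtRep p).comp (wreathSym k 2).subtype))
    {g g' s : Equiv.Perm (Fin (2 * k))} (hs : s ∈ youngSubgroup p)
    (h : s • g⁻¹ • basePartition k = g'⁻¹ • basePartition k) : x.1.coeff g' = x.1.coeff g := by
  have hmem : g' * s * g⁻¹ ∈ wreathSym k 2 := by
    rw [← stabilizer_basePartition, MulAction.mem_stabilizer_iff, mul_smul, mul_smul, h,
      smul_inv_smul]
  rw [← coeff_mul_of_mem_youngSubgroup x g' hs, ← coeff_mul_of_mem_invariants hx hmem g,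
    inv_mul_cancel_right]

theorem indiscrete_mem_Lam (hk : 3 ≤ k) :
    Nat.Partition.indiscrete (2 * k) ∈ Lam (wreathSym k 2) := by
  have hp : (Nat.Partition.indiscrete (2 * k)).parts = {2 * k} :=
    Nat.Partition.indiscrete_parts (by omega)
  refine mem_Lam_of_coeff ?_ 1 ?_
  · intro h _ σ hσ s _ _
    have : σ = 1 := Equiv.ext fun i => Fin.ext (by
      have := hσ i
      rwa [col_of_parts_singleton hp, col_of_parts_singleton hp] at this)
    rw [this, map_one]
  · intro x _ h1 g
    have hg : g ∈ youngSubgroup (Nat.Partition.indiscrete (2 * k)) := fun i => by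
      rw [row_of_parts_singleton hp, row_of_parts_singleton hp]
    rw [← one_mul g, coeff_mul_of_mem_youngSubgroup x 1 hg, h1]

theorem notMem_Lam_of_hook (hk : 3 ≤ k) {p : (2 * k).Partition} (hp : p.parts = {2 * k - 1, 1}) :
    p ∉ Lam (wreathSym k 2) := by
  refine notMem_Lam_of_coeff fun x hx g => ?_
  have hne : (⟨0, by omega⟩ : Fin (2 * k)) ≠ ⟨2 * k - 1, by omega⟩ := by
    simp only [ne_eq, Fin.ext_iff]; omega
  have hτ : Equiv.swap (⟨0, by omega⟩ : Fin (2 * k)) ⟨2 * k - 1, by omega⟩ ∈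
      columnSubgroup p := by
    intro i
    rw [col_of_parts_pair hp (by omega), col_of_parts_pair hp (by omega), Equiv.swap_apply_def]
    simp only [Fin.ext_iff]
    split_ifs <;> simp_all
  have hsum := sum_coeff_eq_zero hτ (Equiv.Perm.sign_swap hne) x
  have hconst (g' : Equiv.Perm (Fin (2 * k))) : x.1.coeff g' = x.1.coeff g := by
    obtain ⟨s, hs, h⟩ := exists_mem_youngSubgroup_smul_eq_of_hook hk hp
      (g⁻¹ • basePartition k) (g'⁻¹ • basePartition k)
    exact coeff_eq_of_smul_eq hx hs h
  simp only [hconst, Finset.sum_const, Finset.card_univ, smul_eq_zero] at hsum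
  exact hsum.resolve_left Fintype.card_ne_zero

theorem mem_columnSubgroup_partitionTwo (hk : 3 ≤ k) (σ : Equiv.Perm (Fin (2 * k))) :
    σ ∈ columnSubgroup (partitionTwo k hk) ↔
      ∀ i, (if (σ i : ℕ) < 2 * k - 2 then (σ i : ℕ) else σ i - (2 * k - 2)) =
        if (i : ℕ) < 2 * k - 2 then (i : ℕ) else i - (2 * k - 2) := by
  refine forall_congr' fun i => ?_
  rw [col_of_parts_pair rfl (by omega), col_of_parts_pair rfl (by omega)]

theorem swap_mem_columnSubgroup_partitionTwo (hk : 3 ≤ k) {a b : Fin (2 * k)}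
    (ha : (a : ℕ) < 2) (hb : (b : ℕ) = 2 * k - 2 + a) :
    Equiv.swap a b ∈ columnSubgroup (partitionTwo k hk) := by
  rw [mem_columnSubgroup_partitionTwo]
  intro i
  rw [Equiv.swap_apply_def]
  simp only [Fin.ext_iff]
  split_ifs <;> simp_all <;> omega

theorem eq_one_of_mem_columnSubgroup_partitionTwo (hk : 3 ≤ k) {σ : Equiv.Perm (Fin (2 * k))}
    (hσ : σ ∈ columnSubgroup (partitionTwo k hk))
    (hfix : ∀ i : Fin (2 * k), 2 * k - 2 ≤ (i : ℕ) → σ i = i) : σ = 1 := by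
  rw [mem_columnSubgroup_partitionTwo] at hσ
  ext i
  rw [Equiv.Perm.one_apply]
  rcases lt_or_ge (i : ℕ) (2 * k - 2) with hi | hi
  · have h1 : ((σ i : Fin (2 * k)) : ℕ) < 2 * k - 2 := by
      by_contra! h
      rw [σ.injective (hfix (σ i) h)] at h
      omega
    simpa [hi, h1] using hσ i
  · rw [hfix i hi]

/-- The column stabilizer of `[2k - 2, 2]` is generated by `(1, 2k - 1)` and `(2, 2k)`, and its
elements that leave the last two points in a common block are `1` and the product of the two. -/
theorem sign_eq_one_of_mem_columnSubgroup_partitionTwo (hk : 3 ≤ k)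
    {σ : Equiv.Perm (Fin (2 * k))} (hσ : σ ∈ columnSubgroup (partitionTwo k hk))
    (h : (σ ⟨2 * k - 2, by omega⟩ : ℕ) < k ↔ (σ ⟨2 * k - 1, by omega⟩ : ℕ) < k) :
    Equiv.Perm.sign σ = 1 := by
  have hcol := (mem_columnSubgroup_partitionTwo hk σ).1 hσ
  have h1 := hcol ⟨2 * k - 2, by omega⟩
  have h2 := hcol ⟨2 * k - 1, by omega⟩
  have hcases : ((σ ⟨2 * k - 2, by omega⟩ : ℕ) = 2 * k - 2 ∧
      (σ ⟨2 * k - 1, by omega⟩ : ℕ) = 2 * k - 1) ∨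
      ((σ ⟨2 * k - 2, by omega⟩ : ℕ) = 0 ∧ (σ ⟨2 * k - 1, by omega⟩ : ℕ) = 1) := by
    simp only at h1 h2
    split_ifs at h1 h2 <;> omega
  rcases hcases with ⟨e1, e2⟩ | ⟨e1, e2⟩
  · have hσ1 : σ = 1 := eq_one_of_mem_columnSubgroup_partitionTwo hk hσ fun i hi => by
      rcases eq_or_eq_of_le_val hk hi with hi | hi <;> rw [hi]
      exacts [Fin.ext e2, Fin.ext e1]
    rw [hσ1, map_one]
  · set a : Fin (2 * k) := ⟨0, by omega⟩ with ha
    set b : Fin (2 * k) := ⟨1, by omega⟩ with hb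
    set c : Fin (2 * k) := ⟨2 * k - 2, by omega⟩ with hc
    set d : Fin (2 * k) := ⟨2 * k - 1, by omega⟩ with hd
    have e1' : σ c = a := Fin.ext e1
    have e2' : σ d = b := Fin.ext e2
    have hac : a ≠ c := by simp only [ha, hc, ne_eq, Fin.ext_iff]; omega
    have hbd : b ≠ d := by simp only [hb, hd, ne_eq, Fin.ext_iff]; omega
    have hab : a ≠ b := by simp [ha, hb, Fin.ext_iff]
    have had : a ≠ d := by simp only [ha, hd, ne_eq, Fin.ext_iff]; omega
    have hcd : c ≠ d := by simp only [hc, hd, ne_eq, Fin.ext_iff]; omega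
    have hmem : Equiv.swap a c * Equiv.swap b d * σ ∈ columnSubgroup (partitionTwo k hk) :=
      mul_mem (mul_mem
        (swap_mem_columnSubgroup_partitionTwo hk (by simp [ha]) (by simp [ha, hc]))
        (swap_mem_columnSubgroup_partitionTwo hk (by simp [hb]) (by simp only [hb, hd]; omega))) hσ
    have h1 := eq_one_of_mem_columnSubgroup_partitionTwo hk hmem fun i hi => by
      rcases eq_or_eq_of_le_val hk hi with hi | hi <;>
        rw [hi, Equiv.Perm.mul_apply, Equiv.Perm.mul_apply]
      · rw [e2', Equiv.swap_apply_left, Equiv.swap_apply_of_ne_of_ne had.symm hcd.symm]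
      · rw [e1', Equiv.swap_apply_of_ne_of_ne hab had, Equiv.swap_apply_left]
    have hsign := congrArg Equiv.Perm.sign h1
    rw [map_mul, map_mul, Equiv.Perm.sign_swap hac, Equiv.Perm.sign_swap hbd, map_one] at hsign
    simpa using hsign

theorem partitionTwo_mem_Lam (hk : 3 ≤ k) : partitionTwo k hk ∈ Lam (wreathSym k 2) := by
  obtain ⟨⟨P, hP⟩, ⟨Q, hQ⟩⟩ := exists_mem_and_exists_notMem_lastTwoTogether hk
  have htrans := isPretransitive_uniformPartition (k := k)
  obtain ⟨g₁, h₁⟩ := htrans.exists_smul_eq (basePartition k) P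
  obtain ⟨g₂, h₂⟩ := htrans.exists_smul_eq (basePartition k) Q
  refine mem_Lam_of_coeff ?_ g₁⁻¹ ?_
  · intro h hh σ hσ s hs he
    refine sign_eq_one_of_mem_columnSubgroup_partitionTwo hk hσ ?_
    have hσe : σ = h⁻¹ * s⁻¹ := by
      rw [← mul_left_cancel_iff (a := h), ← mul_right_cancel_iff (a := s), he]; group
    have hs' := (mem_youngSubgroup_of_parts_pair rfl (by omega) _).1 (inv_mem hs)
    have hs1 := hs' ⟨2 * k - 2, by omega⟩
    have hs2 := hs' ⟨2 * k - 1, by omega⟩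
    simp only at hs1 hs2
    rw [hσe, Equiv.Perm.mul_apply, Equiv.Perm.mul_apply]
    have hh' := inv_mem hh
    rw [← stabilizer_basePartition, mem_stabilizer_basePartition] at hh'
    rcases hh' with hh' | hh'
    · rw [hh', hh']; omega
    · rw [← not_iff_not, hh', hh']; omega
  · intro x hx h0
    -- The coefficients vanish on the orbit of `P` and are constant on that of `Q`; since they sum
    -- to zero, they vanish everywhere.
    have hτ := swap_mem_columnSubgroup_partitionTwo hk (a := ⟨0, by omega⟩)
      (b := ⟨2 * k - 2, by omega⟩) (by simp) (by simp)
    have hsum := sum_coeff_eq_zero hτ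
      (Equiv.Perm.sign_swap (by simp only [ne_eq, Fin.ext_iff]; omega)) x
    have hx1 (g : Equiv.Perm (Fin (2 * k))) (hg : g⁻¹ • basePartition k ∈ lastTwoTogether k) :
        x.1.coeff g = 0 := by
      obtain ⟨s, hs, h⟩ := exists_mem_youngSubgroup_partitionTwo_smul_eq hk (iff_of_true hP hg)
      rw [← h0]
      exact coeff_eq_of_smul_eq hx hs (by rw [inv_inv, h₁, h])
    have hx2 (g : Equiv.Perm (Fin (2 * k))) (hg : g⁻¹ • basePartition k ∉ lastTwoTogether k) :
        x.1.coeff g = x.1.coeff g₂⁻¹ := by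
      obtain ⟨s, hs, h⟩ := exists_mem_youngSubgroup_partitionTwo_smul_eq hk (iff_of_false hQ hg)
      exact coeff_eq_of_smul_eq hx hs (by rw [inv_inv, h₂, h])
    classical
    have hx3 (g : Equiv.Perm (Fin (2 * k))) : x.1.coeff g =
        if g⁻¹ • basePartition k ∈ lastTwoTogether k then 0 else x.1.coeff g₂⁻¹ := by
      split_ifs with hg
      exacts [hx1 g hg, hx2 g hg]
    have h2 : x.1.coeff g₂⁻¹ = 0 := by
      rw [Finset.sum_congr rfl fun g _ => hx3 g, Finset.sum_ite, Finset.sum_const_zero, zero_add,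
        Finset.sum_const, smul_eq_zero] at hsum
      refine hsum.resolve_left (Finset.card_ne_zero_of_mem (a := g₂⁻¹) ?_)
      rw [Finset.mem_filter, inv_inv, h₂]
      exact ⟨Finset.mem_univ _, hQ⟩
    intro g
    rw [hx3, h2, ite_self]

end Wreath

/-! ### Dominance -/

theorem partialSum_le {n : ℕ} (q : n.Partition) (j : ℕ) : partialSum q j ≤ n := by
  have h := congrArg Multiset.sum (Multiset.sort_eq q.parts (· ≥ ·))
  rw [Multiset.sum_coe, q.parts_sum] at h
  conv_rhs => rw [← h]
  exact (List.take_sublist _ _).sum_le_sum fun _ _ => Nat.zero_le _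

/-- A partition of `n` with largest part at least `n - 1` is `[n]` or `[n - 1, 1]`. -/
theorem parts_eq_of_le_partialSum_one {n : ℕ} (hn : 2 ≤ n) (q : n.Partition)
    (h : n - 1 ≤ partialSum q 1) : q.parts = {n} ∨ q.parts = {n - 1, 1} := by
  obtain ⟨l, hl⟩ : ∃ l, q.parts.sort (· ≥ ·) = l := ⟨_, rfl⟩
  have hparts : (l : Multiset ℕ) = q.parts := by rw [← hl, Multiset.sort_eq]
  have hsum : l.sum = n := by rw [← Multiset.sum_coe, hparts, q.parts_sum]
  have hpos {i : ℕ} (hi : i ∈ l) : 0 < i := q.parts_pos (by rw [← hparts]; exact hi)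
  rw [partialSum, hl] at h
  rcases l with _ | ⟨a, _ | ⟨b, _ | ⟨c, l⟩⟩⟩
  · simp at hsum; omega
  · left
    rw [← hparts]
    simp at hsum
    simp [hsum]
  · right
    have hb := hpos (i := b) (by simp)
    simp at hsum h
    rw [← hparts, show a = n - 1 by omega, show b = 1 by omega]
    rfl
  · have hb := hpos (i := b) (by simp)
    have hc := hpos (i := c) (by simp)
    simp at hsum h
    omega

theorem partitionTwo_dominates {k : ℕ} (hk : 3 ≤ k) {q : (2 * k).Partition}
    (hq : partialSum q 1 ≤ 2 * k - 2) : Dominates (partitionTwo k hk) q := by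
  intro j
  rw [partialSum_of_parts_pair (show (partitionTwo k hk).parts = {2 * k - 2, 2} from rfl)
    (by omega)]
  split_ifs with h0 h1
  · simp [h0, partialSum]
  · rwa [h1]
  · exact (partialSum_le q j).trans (by omega)

theorem isSecondLargest_partitionTwo {k : ℕ} (hk : 3 ≤ k) :
    IsSecondLargest (Lam (wreathSym k 2)) (partitionTwo k hk) := by
  have hind : (Nat.Partition.indiscrete (2 * k)).parts = {2 * k} :=
    Nat.Partition.indiscrete_parts (by omega)
  refine ⟨indiscrete_mem_Lam hk, partitionTwo_mem_Lam hk, fun h => ?_, fun q hq hne => ?_⟩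
  · have hcard := congrArg (fun p => Multiset.card p.parts) h
    simp only [hind] at hcard
    simp [partitionTwo] at hcard
  · refine partitionTwo_dominates hk ?_
    by_contra! hlt
    rcases parts_eq_of_le_partialSum_one (by omega) q (by omega) with h | h
    · exact hne (Nat.Partition.ext (h.trans hind.symm))
    · exact notMem_Lam_of_hook hk h hq

end GelfandSym

open GelfandSym
theorem mainTheorem2 (k : ℕ) (hk : 3 ≤ k) :
    IsMultiplicityFree (wreathSym k 2) ∧
    IsSecondLargest (Lam (wreathSym k 2)) (partitionTwo k hk) ∧
    MulAction.IsPretransitive (Equiv.Perm (Fin (2 * k))) (UniformPartition k) ∧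
    MulAction.stabilizer (Equiv.Perm (Fin (2 * k))) (basePartition k) = wreathSym k 2 ∧
    (∀ T : Set (UniformPartition k),
      IsOrbit (youngSubgroup (partitionTwo k hk)) T ↔ T = lastTwoTogether k ∨ T = (lastTwoTogether k)ᶜ) ∧
    (∀ O : Set (UniformPartition k × UniformPartition k),
      IsOrbital (Equiv.Perm (Fin (2 * k))) O →
        ¬ IsCoclique O (lastTwoTogether k) ∧ ¬ IsCoclique O (lastTwoTogether k)ᶜ) ∧
    (∀ S : Set (Equiv.Perm (Fin (2 * k)) ⧸ wreathSym k 2),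
      IsOrbit (youngSubgroup (partitionTwo k hk)) S →
      ¬ ∃ O, IsOrbital (Equiv.Perm (Fin (2 * k))) O ∧ IsCoclique O S) := by
  refine ⟨isMultiplicityFree_of_symmetric exists_inv_eq_mul_mul, isSecondLargest_partitionTwo hk,
    isPretransitive_uniformPartition, stabilizer_basePartition,
    isOrbit_youngSubgroup_partitionTwo hk, fun O hO => not_isCoclique_lastTwoTogether hk hO,
    not_isCoclique_quotient stabilizer_basePartition _ fun T O hT hO => ?_⟩
  rcases (isOrbit_youngSubgroup_partitionTwo hk T).1 hT with rfl | rfl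
  exacts [(not_isCoclique_lastTwoTogether hk hO).1, (not_isCoclique_lastTwoTogether hk hO).2]
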